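/- Let $g_1,\dots,g_m\in\mathbb R\{x,y\}$ be convergent power series with real coefficients, regarded as holomorphic functions near the origin of $\mathbb C^2$, and let $J=(g_1,\dots,g_m)$ be the ideal they generate. Assume that $J$ has a monomialization near the origin that blows up only real points: there is a morphism $\pi:Y\to\mathbb C^2$, a composite of finitely many (possibly no) blow-ups of points lying over the origin, each of them real (that is, fixed by the lift of complex conjugation to the surface obtained so far), such that at every point of $\pi^{-1}(0)$ the ideal of germs generated by $g_1\circ\pi,\dots,g_m\circ\pi$ is generated by a monomial $u^av^b$ ($a,b\ge 0$) in some local holomorphic coordinates $(u,v)$ of $Y$ centred at that point. Assume moreover that every branch at the origin of the common zero set $\{g_1=\dots=g_m=0\}\subset\mathbb C^2$ is mapped to itself by complex conjugation (there is nothing to check if the origin is an isolated common zero, or not a common zero). Let $f$ be holomorphic near the origin of $\mathbb C^2$. Then the following are equivalent. 1. There are $C>0$ and a neighbourhood $U$ of the origin in $\mathbb R^2$ such that $|f(x,y)|\le C\sum_i|g_i(x,y)|$ for all $(x,y)\in U$. 2. There are $C>0$ and a neighbourhood $U$ of the origin in $\mathbb C^2$ such that $|f(x,y)|\le C\sum_i|g_i(x,y)|$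 for all $(x,y)\in U$. -/

import Mathlib

open Filter Topology

/-- `g` is (a representative of) an element of the ring `ℝ{x,y}`: near the origin of `ℂ²` it is
the sum of a convergent power series in two variables with real coefficients. -/
def IsRealSeries (g : ℂ × ℂ → ℂ) : Prop :=
  AnalyticAt ℂ g 0 ∧
    ∃ a : ℕ × ℕ → ℝ, ∀ᶠ z in 𝓝 (0 : ℂ × ℂ),
      HasSum (fun n : ℕ × ℕ => (a n : ℂ) * z.1 ^ n.1 * z.2 ^ n.2) (g z)

/-- Inclusion of `ℝ²` in `ℂ²`. -/
def toComplexPt (p : ℝ × ℝ) : ℂ × ℂ := ((p.1 : ℂ), (p.2 : ℂ))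

/-- Complex conjugation on `ℂ²`. -/
def conjPt (z : ℂ × ℂ) : ℂ × ℂ := (starRingEnd ℂ z.1, starRingEnd ℂ z.2)

/-- The ideal of germs at `0 ∈ ℂ²` generated by `G 0, …, G (m-1)` is generated by a monomial
`u ^ a * v ^ b` in some system `(u, v)` of local holomorphic coordinates centred at `0`.
The two clauses after the coordinates are the two inclusions between the ideals. -/
def IsMonomialAtOrigin {m : ℕ} (G : Fin m → ℂ × ℂ → ℂ) : Prop :=
  ∃ (u v : ℂ × ℂ → ℂ) (a b : ℕ),
    AnalyticAt ℂ u 0 ∧ AnalyticAt ℂ v 0 ∧ u 0 = 0 ∧ v 0 = 0 ∧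
    LinearIndependent ℂ ![fderiv ℂ u 0, fderiv ℂ v 0] ∧
    (∀ i, ∃ h : ℂ × ℂ → ℂ, AnalyticAt ℂ h 0 ∧
      ∀ᶠ z in 𝓝 (0 : ℂ × ℂ), G i z = h z * (u z ^ a * v z ^ b)) ∧
    (∃ c : Fin m → ℂ × ℂ → ℂ, (∀ i, AnalyticAt ℂ (c i) 0) ∧
      ∀ᶠ z in 𝓝 (0 : ℂ × ℂ), u z ^ a * v z ^ b = ∑ i, c i z * G i z)

/-- The points of the exceptional curve `E ≅ ℂℙ¹` of the blow-up of the origin of `ℂ²` are the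
directions: `c : ℂ` stands for the line `[1 : c]` and `∞` for the line `[0 : 1]`.
`directionChart d` is the blow-down map, written in standard affine coordinates of the blow-up
centred at the point `d` of `E`. -/
noncomputable def directionChart : OnePoint ℂ → ℂ × ℂ → ℂ × ℂ
  | none => fun z => (z.1 * z.2, z.2)
  | some c => fun z => (z.1, z.1 * (z.2 + c))

/-- A finite sequence of point blow-ups over (a neighbourhood of) the origin of a surface with
given local coordinates: either nothing is blown up, or the origin is blown up and then, at
each of the finitely many points `d ∈ S` of the exceptional curve, the sequence `next d` of
point blow-ups is performed over `d`, in the coordinates of `directionChart d`.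
The values `next d` for `d ∉ S` are not used. -/
inductive PointBlowUps : Type
  | nothing : PointBlowUps
  | blowUp (S : Finset (OnePoint ℂ)) (next : OnePoint ℂ → PointBlowUps) : PointBlowUps

/-- Let `π : Y → ℂ²` be the composite of the blow-ups in `T`. `T.IsChart χ` says that `χ` is the
map `π` written in the standard local coordinates of `Y` centred at some point of the fibre
`π⁻¹(0)`; every point of the fibre has exactly one such chart. -/
inductive PointBlowUps.IsChart : PointBlowUps → (ℂ × ℂ → ℂ × ℂ) → Prop
  | origin : IsChart .nothing id
  | unchanged (S : Finset (OnePoint ℂ)) (next : OnePoint ℂ → PointBlowUps)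
      (d : OnePoint ℂ) (hd : d ∉ S) : IsChart (.blowUp S next) (directionChart d)
  | continued (S : Finset (OnePoint ℂ)) (next : OnePoint ℂ → PointBlowUps)
      (d : OnePoint ℂ) (hd : d ∈ S) (χ : ℂ × ℂ → ℂ × ℂ) (hχ : IsChart (next d) χ) :
      IsChart (.blowUp S next) (directionChart d ∘ χ)

/-- The direction `d ∈ ℂℙ¹` is real, that is, fixed by complex conjugation. -/
def IsRealDirection (d : OnePoint ℂ) : Prop :=
  d = OnePoint.infty ∨ ∃ c : ℝ, d = ((c : ℂ) : OnePoint ℂ)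

/-- All the points blown up in `T` are real, for the real structure lifted from `ℂ²`.
(At a real point `d` the coordinates of `directionChart d` are real, so that conjugation lifted
to the blow-up is again the standard one in these coordinates.) -/
inductive PointBlowUps.OnlyReal : PointBlowUps → Prop
  | nothing : OnlyReal .nothing
  | blowUp (S : Finset (OnePoint ℂ)) (next : OnePoint ℂ → PointBlowUps)
      (hS : ∀ d ∈ S, IsRealDirection d) (hnext : ∀ d ∈ S, OnlyReal (next d)) :
      OnlyReal (.blowUp S next)

/-- The composite `π : Y → ℂ²` of the blow-ups in `T` is a monomialization, near the origin, of
the ideal generated by the `g i`: the pulled back ideal, generated by the `g i ∘ π`, is monomial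
in suitable local coordinates at every point of the fibre of `π` over the origin (hence, `π`
being proper, at every point of `Y` over some neighbourhood of the origin). -/
def PointBlowUps.IsMonomialization {m : ℕ} (T : PointBlowUps) (g : Fin m → ℂ × ℂ → ℂ) : Prop :=
  ∀ χ, T.IsChart χ → IsMonomialAtOrigin (fun i => g i ∘ χ)

/-- Every branch at the origin of the common zero set of the `g i` is mapped to itself by complex
conjugation. Branches are the germs of images of analytic arcs `γ : (ℂ, 0) → (ℂ², 0)`; if `γ` is
constant the condition is void. -/
def ZeroCurveHasRealBranches {m : ℕ} (g : Fin m → ℂ × ℂ → ℂ) : Prop :=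
  ∀ γ : ℂ → ℂ × ℂ, AnalyticAt ℂ γ 0 → γ 0 = 0 →
    (∀ᶠ t in 𝓝 (0 : ℂ), ∀ i, g i (γ t) = 0) →
      ∀ V ∈ 𝓝 (0 : ℂ), ∀ᶠ t in 𝓝 (0 : ℂ), conjPt (γ t) ∈ γ '' V

/-! Only the passage from real to complex points needs work; it goes by induction on the blow-ups.

Suppose the ideal is already generated by a monomial $u^av^b$, so that $\sum|g_i|$ is comparable to
$|u^av^b|$. A factor with positive exponent cuts out a branch of the zero set. That branch is
invariant under conjugation, so the factor can be replaced by a comparable real coordinate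
(`IsCoordinates.exists_real`). In real coordinates, a bound by $|s|^a|t|^b$ on $\mathbb R^2$ makes
low-order Taylor coefficients vanish at real points, hence at complex ones by the identity theorem.
The Schwarz lemma turns this vanishing back into a bound (`isBigO_monomial_of_real`).

After a blow-up, compactness of the exceptional curve reduces the claim to estimates near each of
its points (`isBigO_of_directionChart`). At real points all hypotheses lift. A non-real point is
never blown up and has no real points of the surface nearby, so another argument is needed
(`isBigO_of_nonreal`). A branch with a non-real tangent is not conjugation invariant, so only the
exceptional curve $x=0$ can occur in the zero set there, and the ideal is generated by $x^a$. Then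
every $g_i$ has order at least $a$ at the origin, hence so does $f$, and its pullback is $O(x^a)$.
-/

/-! ### Orders of vanishing along lines, read off from real points -/

section LineOrder

variable {E : Type*} [NormedAddCommGroup E] [NormedSpace ℂ E]

/-- Once the lower coefficients vanish, the term of degree $i<a$ is $O(\tau^{i+1})$; dividing by
$\tau^i$ and letting $\tau\to0^+$ kills its coefficient. Real $\tau$ suffice for this. -/
theorem coeff_diag_eq_zero_of_isBigO_real {F : E → ℂ} {x w : E} {p : FormalMultilinearSeries ℂ E ℂ}
    (hp : HasFPowerSeriesAt F p x) {a : ℕ}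
    (h : (fun τ : ℝ => F (x + (τ : ℂ) • w)) =O[𝓝 0] fun τ : ℝ => τ ^ a) :
    ∀ i < a, p i (fun _ => w) = 0 := by
  intro i
  induction i using Nat.strong_induction_on with
  | _ i ih =>
    intro hia
    have hl : Tendsto (fun τ : ℝ => (τ : ℂ) • w) (𝓝 0) (𝓝 0) := by
      have : Continuous (fun τ : ℝ => (τ : ℂ) • w) := by fun_prop
      simpa using this.tendsto 0
    have h1 := (hp.isBigO_sub_partialSum_pow (i + 1)).comp_tendsto hl
    have h2 : (fun τ : ℝ => ‖(τ : ℂ) • w‖ ^ (i + 1)) =O[𝓝 0] fun τ : ℝ => τ ^ (i + 1) := by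
      refine Asymptotics.IsBigO.pow (f := fun τ : ℝ => ‖(τ : ℂ) • w‖) ?_ _
      refine Asymptotics.IsBigO.of_bound ‖w‖ (Eventually.of_forall fun τ => ?_)
      simp [norm_smul, mul_comm]
    have h3 : (fun τ : ℝ => F (x + (τ : ℂ) • w)) =O[𝓝 0] fun τ : ℝ => τ ^ (i + 1) :=
      h.trans (Asymptotics.IsBigO.of_bound 1 (by
        filter_upwards [Metric.ball_mem_nhds (0 : ℝ) one_pos] with τ hτ
        rw [one_mul, norm_pow, norm_pow]
        exact pow_le_pow_of_le_one (norm_nonneg _) (mem_ball_zero_iff.1 hτ).le hia))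
    have h4 : (fun τ : ℝ => ((τ : ℂ) ^ i) * p i (fun _ => w)) =O[𝓝 0]
        fun τ : ℝ => τ ^ (i + 1) := by
      refine (h3.sub (h1.trans h2)).congr_left fun τ => ?_
      have : p.partialSum (i + 1) ((τ : ℂ) • w) = (τ : ℂ) ^ i * p i (fun _ => w) := by
        rw [FormalMultilinearSeries.partialSum, Finset.sum_range_succ, Finset.sum_eq_zero, zero_add]
        · rw [show (fun _ : Fin i => (τ : ℂ) • w) = fun j => (fun _ => (τ : ℂ)) j • (fun _ => w) j
            from rfl, ContinuousMultilinearMap.map_smul_univ]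
          simp
        · intro j hj
          rw [show (fun _ : Fin j => (τ : ℂ) • w) = fun j => (fun _ => (τ : ℂ)) j • (fun _ => w) j
            from rfl, ContinuousMultilinearMap.map_smul_univ,
            ih j (Finset.mem_range.1 hj) ((Finset.mem_range.1 hj).trans hia), smul_zero]
      simp only [Function.comp, this, sub_sub_cancel]
    obtain ⟨C, hC⟩ := h4.bound
    have h5 : ∀ᶠ τ : ℝ in 𝓝[>] 0, ‖p i (fun _ => w)‖ ≤ C * τ := by
      filter_upwards [nhdsWithin_le_nhds hC, self_mem_nhdsWithin] with τ h1 h2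
      have h2 : 0 < τ := h2
      have h3 : 0 < τ ^ i := by positivity
      simp only [norm_mul, norm_pow, Complex.norm_real, Real.norm_eq_abs, abs_of_pos h2] at h1
      rw [pow_succ, mul_left_comm] at h1
      exact le_of_mul_le_mul_left h1 h3
    have h6 : Tendsto (fun τ : ℝ => C * τ) (𝓝[>] 0) (𝓝 0) := by
      have : Continuous (fun τ : ℝ => C * τ) := by fun_prop
      simpa using (this.tendsto 0).mono_left nhdsWithin_le_nhds
    exact norm_le_zero_iff.1 (ge_of_tendsto h6 h5)

theorem isBigO_line_of_coeff_diag_eq_zero {F : E → ℂ} {x w : E}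
    {p : FormalMultilinearSeries ℂ E ℂ} (hp : HasFPowerSeriesAt F p x) {a : ℕ}
    (h : ∀ i < a, p i (fun _ => w) = 0) :
    (fun τ : ℂ => F (x + τ • w)) =O[𝓝 0] fun τ : ℂ => τ ^ a := by
  have hl : Tendsto (fun τ : ℂ => τ • w) (𝓝 0) (𝓝 0) := by
    have : Continuous (fun τ : ℂ => τ • w) := by fun_prop
    simpa using this.tendsto 0
  have h1 := (hp.isBigO_sub_partialSum_pow a).comp_tendsto hl
  have h2 : (fun τ : ℂ => ‖τ • w‖ ^ a) =O[𝓝 0] fun τ : ℂ => τ ^ a := by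
    refine Asymptotics.IsBigO.pow (f := fun τ : ℂ => ‖τ • w‖) ?_ _
    refine Asymptotics.IsBigO.of_bound ‖w‖ (Eventually.of_forall fun τ => ?_)
    simp [norm_smul, mul_comm]
  refine (h1.trans h2).congr_left fun τ => ?_
  have : p.partialSum a (τ • w) = 0 := by
    refine Finset.sum_eq_zero fun j hj => ?_
    rw [show (fun _ : Fin j => τ • w) = fun j => (fun _ => τ) j • (fun _ => w) j
      from rfl, ContinuousMultilinearMap.map_smul_univ, h j (Finset.mem_range.1 hj), smul_zero]
  simp [this]

theorem isBigO_norm_pow_of_coeff_diag_eq_zero {F : E → ℂ}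
    {p : FormalMultilinearSeries ℂ E ℂ} (hp : HasFPowerSeriesAt F p 0) {a : ℕ}
    (h : ∀ i < a, ∀ w, p i (fun _ => w) = 0) :
    F =O[𝓝 0] fun z => ‖z‖ ^ a := by
  refine (hp.isBigO_sub_partialSum_pow a).congr_left fun z => ?_
  have : p.partialSum a z = 0 :=
    Finset.sum_eq_zero fun j hj => h j (Finset.mem_range.1 hj) z
  simp [this]

theorem analyticOnNhd_diag {n : ℕ} (q : ContinuousMultilinearMap ℂ (fun _ : Fin n => E) ℂ) :
    AnalyticOnNhd ℂ (fun z : E => q (fun _ => z)) Set.univ := by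
  intro z _
  have h1 : AnalyticAt ℂ (fun z : E => (fun _ : Fin n => z)) z :=
    (ContinuousLinearMap.pi fun _ : Fin n => ContinuousLinearMap.id ℂ E).analyticAt z
  have h2 : AnalyticAt ℂ q (fun _ => z) := q.analyticAt
  exact h2.comp (g := q) h1

end LineOrder

theorem frequently_real_nhdsNE_zero {P : ℂ → Prop} (h : ∀ᶠ t : ℝ in 𝓝 0, P t) :
    ∃ᶠ t in 𝓝[≠] (0 : ℂ), P t := by
  have h1 : Tendsto (fun t : ℝ => (t : ℂ)) (𝓝[≠] 0) (𝓝[≠] 0) := by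
    refine tendsto_nhdsWithin_iff.2 ⟨?_, ?_⟩
    · simpa using (Complex.continuous_ofReal.tendsto 0).mono_left nhdsWithin_le_nhds
    · filter_upwards [self_mem_nhdsWithin] with t ht
      simpa using ht
  exact h1.frequently (h.filter_mono nhdsWithin_le_nhds).frequently

/-- The one-variable identity theorem is applied twice: in the second variable with the first one
real, then in the first variable with the second one arbitrary. -/
theorem eq_zero_of_analyticOnNhd_of_real {q : ℂ × ℂ → ℂ} (hq : AnalyticOnNhd ℂ q Set.univ)
    (h : ∀ p, q (toComplexPt p) = 0) : q = 0 := by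
  have h1 : ∀ (s : ℝ) (t : ℂ), q (s, t) = 0 := by
    intro s
    have ha : AnalyticOnNhd ℂ (fun t : ℂ => q (s, t)) Set.univ := fun t _ =>
      AnalyticAt.fun_comp (hq _ trivial) (by fun_prop)
    have := ha.eqOn_zero_of_preconnected_of_frequently_eq_zero isPreconnected_univ
      (Set.mem_univ 0) (frequently_real_nhdsNE_zero (Eventually.of_forall fun t => h (s, t)))
    exact fun t => this (Set.mem_univ t)
  have h2 : ∀ (t s : ℂ), q (s, t) = 0 := by
    intro t
    have ha : AnalyticOnNhd ℂ (fun s : ℂ => q (s, t)) Set.univ := fun s _ =>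
      AnalyticAt.fun_comp (hq _ trivial) (by fun_prop)
    have := ha.eqOn_zero_of_preconnected_of_frequently_eq_zero isPreconnected_univ
      (Set.mem_univ 0) (frequently_real_nhdsNE_zero (Eventually.of_forall fun s => h1 s t))
    exact fun t => this (Set.mem_univ t)
  ext ⟨s, t⟩
  exact h2 t s

/-- A bound by a power of the norm at real points extends to complex points. -/
theorem isBigO_norm_pow_of_real {F : ℂ × ℂ → ℂ} (hF : AnalyticAt ℂ F 0) {a : ℕ}
    (h : (fun p => F (toComplexPt p)) =O[𝓝 0] fun p => ‖p‖ ^ a) :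
    F =O[𝓝 0] fun z => ‖z‖ ^ a := by
  obtain ⟨p, hp⟩ := hF
  refine isBigO_norm_pow_of_coeff_diag_eq_zero hp fun i hi => ?_
  -- The homogeneous part of degree $i$ is entire, so its vanishing on $\mathbb R^2$ is enough.
  have := eq_zero_of_analyticOnNhd_of_real (analyticOnNhd_diag (p i)) fun w => by
    refine coeff_diag_eq_zero_of_isBigO_real hp ?_ i hi
    have hl : Tendsto (fun τ : ℝ => τ • w) (𝓝 0) (𝓝 0) := by
      have : Continuous (fun τ : ℝ => τ • w) := by fun_prop
      simpa using this.tendsto 0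
    have h2 : (fun τ : ℝ => ‖τ • w‖ ^ a) =O[𝓝 0] fun τ : ℝ => τ ^ a := by
      refine Asymptotics.IsBigO.pow (f := fun τ : ℝ => ‖τ • w‖) ?_ _
      refine Asymptotics.IsBigO.of_bound ‖w‖ (Eventually.of_forall fun τ => ?_)
      rw [norm_norm, norm_smul, mul_comm]
    refine ((h.comp_tendsto hl).trans h2).congr_left fun τ => ?_
    simp [toComplexPt]
  exact fun w => congrFun this w

/-- A bound by a power along all lines with direction near a given one extends to a full
neighbourhood. -/
theorem isBigO_norm_pow_of_cone {F : ℂ × ℂ → ℂ} (hF : AnalyticAt ℂ F 0) {a : ℕ} {w₀ : ℂ × ℂ}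
    (h : ∀ᶠ w in 𝓝 w₀, (fun τ : ℝ => F ((τ : ℂ) • w)) =O[𝓝 0] fun τ : ℝ => τ ^ a) :
    F =O[𝓝 0] fun z => ‖z‖ ^ a := by
  obtain ⟨p, hp⟩ := hF
  refine isBigO_norm_pow_of_coeff_diag_eq_zero hp fun i hi => ?_
  have := (analyticOnNhd_diag (p i)).eqOn_zero_of_preconnected_of_eventuallyEq_zero
    isPreconnected_univ (Set.mem_univ w₀) (by
      filter_upwards [h] with w hw
      exact coeff_diag_eq_zero_of_isBigO_real hp (by simpa using hw) i hi)
  exact fun w => this (Set.mem_univ w)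

/-- Points of a bidisc: a bound `C |s| ^ a` on real points forces order at least `a` in the first
variable along every complex slice. -/
theorem isBigO_slice_of_real {F : ℂ × ℂ → ℂ} {r : ℝ} (hr : 0 < r)
    (hF : AnalyticOnNhd ℂ F (Metric.ball 0 r)) {a : ℕ} {C : ℝ}
    (h : ∀ s t : ℝ, |s| < r → |t| < r → ‖F (s, t)‖ ≤ C * |s| ^ a) {t : ℂ} (ht : ‖t‖ < r) :
    (fun s : ℂ => F (s, t)) =O[𝓝 0] fun s : ℂ => s ^ a := by
  have hmem : ∀ t : ℂ, ‖t‖ < r → ((0 : ℂ), t) ∈ Metric.ball (0 : ℂ × ℂ) r := fun t ht => by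
    simpa [Prod.norm_def, hr] using ht
  -- The $i$-th derivative in $s$ along $s=0$ is analytic in $t$ and vanishes for real $t$, hence on
  -- the whole disc.
  have hcoef : ∀ i < a, ∀ t : ℂ, ‖t‖ < r →
      iteratedFDeriv ℂ i F (0, t) (fun _ => ((1 : ℂ), (0 : ℂ))) = 0 := by
    intro i hi
    have han : AnalyticOnNhd ℂ
        (fun t : ℂ => iteratedFDeriv ℂ i F (0, t) (fun _ => ((1 : ℂ), (0 : ℂ))))
        (Metric.ball 0 r) := by
      intro t ht
      have h1 := (hF.iteratedFDeriv i) _ (hmem t (mem_ball_zero_iff.1 ht))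
      have h2 : AnalyticAt ℂ (fun t : ℂ => iteratedFDeriv ℂ i F (0, t)) t :=
        h1.fun_comp (g := iteratedFDeriv ℂ i F) (f := fun t : ℂ => ((0 : ℂ), t)) (by fun_prop)
      exact ((ContinuousMultilinearMap.apply ℂ (fun _ : Fin i => ℂ × ℂ) ℂ
        (fun _ => ((1 : ℂ), (0 : ℂ)))).analyticAt _).fun_comp h2
    have := han.eqOn_zero_of_preconnected_of_frequently_eq_zero
      (convex_ball 0 r).isPreconnected (Metric.mem_ball_self hr)
      (frequently_real_nhdsNE_zero (by
        filter_upwards [Metric.ball_mem_nhds (0 : ℝ) hr] with t ht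
        have ht : |t| < r := by simpa using ht
        obtain ⟨p, R, hp⟩ := hF _ (hmem t (by simpa using ht))
        rw [← hp.factorial_smul,
          coeff_diag_eq_zero_of_isBigO_real (a := a) hp.hasFPowerSeriesAt ?_ i hi, smul_zero]
        refine Asymptotics.IsBigO.of_bound C ?_
        filter_upwards [Metric.ball_mem_nhds (0 : ℝ) hr] with s hs
        simpa using h s t (by simpa using hs) ht))
    exact fun t ht => this (mem_ball_zero_iff.2 ht)
  obtain ⟨p, R, hp⟩ := hF _ (hmem t ht)
  have := isBigO_line_of_coeff_diag_eq_zero (a := a) (w := ((1 : ℂ), (0 : ℂ)))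
    hp.hasFPowerSeriesAt fun i hi => by
      have := hp.factorial_smul ((1 : ℂ), (0 : ℂ)) i
      rw [hcoef i hi t ht] at this
      simpa [Nat.factorial_ne_zero] using this
  simpa using this

/-- The Schwarz lemma for a zero of order at least $a$. Its form used here needs a positive order,
so $a=0$ is treated apart. -/
theorem norm_le_of_isBigO_pow {G : ℂ → ℂ} {r M : ℝ} (hG : DifferentiableOn ℂ G (Metric.ball 0 r))
    (hM : ∀ s, ‖s‖ < r → ‖G s‖ ≤ M) {a : ℕ} (hO : G =O[𝓝 0] fun s : ℂ => s ^ a) {s : ℂ}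
    (hs : ‖s‖ < r) : ‖G s‖ ≤ M * (‖s‖ / r) ^ a := by
  rcases a with _ | a
  · simpa using hM s hs
  have hO' : G =O[𝓝 0] fun s : ℂ => ‖s‖ ^ (a + 1) := by
    simpa using hO.norm_right
  have h0 : G 0 = 0 := hO'.eq_zero_imp.self_of_nhds (by simp)
  have := Complex.dist_le_mul_div_pow_of_mapsTo_ball_of_isLittleO (c := 0) (n := a) (R₂ := M) hG
    (fun s hs => by simpa [h0] using hM s (mem_ball_zero_iff.1 hs))
    (by
      simp only [h0, sub_zero]
      exact hO'.trans_isLittleO ((Asymptotics.isLittleO_pow_pow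
        (𝕜 := ℝ) (Nat.lt_succ_self a)).comp_tendsto tendsto_norm_zero))
    (mem_ball_zero_iff.2 hs)
  simpa [h0] using this

/-- A monomial bound at real points of `ℂ²` holds at complex points. -/
theorem isBigO_monomial_of_real {F : ℂ × ℂ → ℂ} (hF : AnalyticAt ℂ F 0) {a b : ℕ}
    (h : (fun p => F (toComplexPt p)) =O[𝓝 0] fun p : ℝ × ℝ => p.1 ^ a * p.2 ^ b) :
    F =O[𝓝 0] fun z => z.1 ^ a * z.2 ^ b := by
  obtain ⟨C, hC0, hC⟩ := h.exists_pos
  obtain ⟨r₁, hr₁, h₁⟩ := Metric.eventually_nhds_iff_ball.1 hC.bound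
  obtain ⟨r₂, hr₂, h₂⟩ := Metric.eventually_nhds_iff_ball.1 hF.eventually_analyticAt
  obtain ⟨r₃, hr₃, h₃⟩ := Metric.eventually_nhds_iff_ball.1
    (hF.continuousAt.norm.eventually_le_const (lt_add_one ‖F 0‖))
  set M := ‖F 0‖ + 1
  obtain ⟨r, hr, hr1, hr2, hr3⟩ : ∃ r, 0 < r ∧ r ≤ r₁ ∧ r ≤ r₂ ∧ r ≤ r₃ :=
    ⟨min r₁ (min r₂ r₃), by positivity, by simp, by simp, by simp⟩
  have hball : ∀ s t : ℂ, ‖s‖ < r → ‖t‖ < r → (s, t) ∈ Metric.ball (0 : ℂ × ℂ) r := by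
    intro s t hs ht
    simpa [Prod.norm_def] using ⟨hs, ht⟩
  have hA : AnalyticOnNhd ℂ F (Metric.ball 0 r) := fun z hz => h₂ z (Metric.ball_subset_ball hr2 hz)
  have hA' : AnalyticOnNhd ℂ (F ∘ Prod.swap) (Metric.ball 0 r) := fun z hz => by
    have hz' : (z.2, z.1) ∈ Metric.ball (0 : ℂ × ℂ) r := by
      simpa [Prod.norm_def, and_comm] using hz
    exact AnalyticAt.fun_comp (g := F) (f := fun z : ℂ × ℂ => (z.2, z.1)) (hA _ hz')
      (analyticAt_snd.prod analyticAt_fst)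
  have hreal : ∀ s t : ℝ, |s| < r → |t| < r → ‖F (s, t)‖ ≤ C * (|s| ^ a * |t| ^ b) := by
    intro s t hs ht
    have := h₁ (s, t) (Metric.ball_subset_ball hr1 (by simpa [Prod.norm_def] using ⟨hs, ht⟩))
    simpa [toComplexPt] using this
  have hs_ord : ∀ t : ℂ, ‖t‖ < r → (fun s : ℂ => F (s, t)) =O[𝓝 0] fun s : ℂ => s ^ a := by
    refine fun t ht => isBigO_slice_of_real hr hA (C := C * r ^ b) (fun s t hs ht => ?_) ht
    refine (hreal s t hs ht).trans ?_
    rw [mul_comm (|s| ^ a), ← mul_assoc]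
    gcongr
  have ht_ord : ∀ s : ℂ, ‖s‖ < r → (fun t : ℂ => F (s, t)) =O[𝓝 0] fun t : ℂ => t ^ b := by
    refine fun s hs => isBigO_slice_of_real (F := F ∘ Prod.swap) hr hA' (C := C * r ^ a)
      (fun t s ht hs => ?_) hs
    refine (hreal s t hs ht).trans ?_
    rw [← mul_assoc]
    gcongr
  have hM : ∀ s t : ℂ, ‖s‖ < r → ‖t‖ < r → ‖F (s, t)‖ ≤ M := fun s t hs ht =>
    h₃ _ (Metric.ball_subset_ball hr3 (hball s t hs ht))
  have hb : ∀ s t : ℂ, ‖s‖ < r → ‖t‖ < r → ‖F (s, t)‖ ≤ M * (‖t‖ / r) ^ b := by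
    intro s t hs ht
    refine norm_le_of_isBigO_pow (G := fun t => F (s, t)) ?_ (fun t ht => hM s t hs ht)
      (ht_ord s hs) ht
    intro t ht
    exact (AnalyticAt.fun_comp (hA _ (hball s t hs (mem_ball_zero_iff.1 ht)))
      (by fun_prop)).differentiableAt.differentiableWithinAt
  -- Schwarz in $s$ at fixed $t$, with the bound just found, which is uniform in $s$, in the role of
  -- the supremum.
  have hab : ∀ s t : ℂ, ‖s‖ < r → ‖t‖ < r →
      ‖F (s, t)‖ ≤ M * (‖t‖ / r) ^ b * (‖s‖ / r) ^ a := by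
    intro s t hs ht
    refine norm_le_of_isBigO_pow (G := fun s => F (s, t)) ?_ (fun s hs => hb s t hs ht)
      (hs_ord t ht) hs
    intro s hs
    exact (AnalyticAt.fun_comp (f := fun s => (s, t)) (hA _ (hball s t (mem_ball_zero_iff.1 hs) ht))
      (by fun_prop)).differentiableAt.differentiableWithinAt
  refine Asymptotics.IsBigO.of_bound (M / r ^ b / r ^ a) ?_
  filter_upwards [Metric.ball_mem_nhds 0 hr] with z hz
  have hz : ‖z.1‖ < r ∧ ‖z.2‖ < r := by simpa [Prod.norm_def] using hz
  refine (hab z.1 z.2 hz.1 hz.2).trans (le_of_eq ?_)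
  rw [norm_mul, norm_pow, norm_pow, div_pow, div_pow]
  ring

/-! ### Complex conjugation of analytic germs -/

section StarConj

variable {E : Type*} [NormedAddCommGroup E] [NormedSpace ℂ E] [StarAddMonoid E]
  [NormedStarGroup E] [StarModule ℂ E]

/-- The multilinear map conjugate to `q`. -/
noncomputable def conjMultilinear {n : ℕ}
    (q : ContinuousMultilinearMap ℂ (fun _ : Fin n => E) ℂ) :
    ContinuousMultilinearMap ℂ (fun _ : Fin n => E) ℂ where
  toFun v := star (q fun i => star (v i))
  map_update_add' v i x y := by
    have h (z : E) : (fun j => star (Function.update v i z j)) =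
        Function.update (fun j => star (v j)) i (star z) := by
      ext j; by_cases hj : j = i <;> [(subst hj; simp); simp [hj]]
    rename_i inst
    obtain rfl : inst = instDecidableEqFin n := Subsingleton.elim _ _
    rw [h, h, h, star_add, q.map_update_add, star_add]
  map_update_smul' v i c x := by
    have h (z : E) : (fun j => star (Function.update v i z j)) =
        Function.update (fun j => star (v j)) i (star z) := by
      ext j; by_cases hj : j = i <;> [(subst hj; simp); simp [hj]]
    rename_i inst
    obtain rfl : inst = instDecidableEqFin n := Subsingleton.elim _ _
    rw [h, h, star_smul, q.map_update_smul, star_smul, star_star]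
  cont := by
    exact continuous_star.comp (q.cont.comp (by fun_prop))

theorem norm_conjMultilinear_le {n : ℕ}
    (q : ContinuousMultilinearMap ℂ (fun _ : Fin n => E) ℂ) : ‖conjMultilinear q‖ ≤ ‖q‖ := by
  refine ContinuousMultilinearMap.opNorm_le_bound (norm_nonneg _) fun v => ?_
  change ‖star (q fun i => star (v i))‖ ≤ _
  rw [norm_star]
  simpa using q.le_opNorm fun i => star (v i)

/-- Conjugating in both source and target keeps each Taylor term complex multilinear and does not
increase its norm, so the conjugated series converges on the same ball. -/
theorem AnalyticAt.star_comp_star {F : E → ℂ} (hF : AnalyticAt ℂ F 0) :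
    AnalyticAt ℂ (fun z => star (F (star z))) 0 := by
  obtain ⟨p, r, hp⟩ := hF
  refine ⟨fun n => conjMultilinear (p n), r, ?_, hp.r_pos, fun {y} hy => ?_⟩
  · refine hp.r_le.trans (FormalMultilinearSeries.radius_le_of_le fun n => ?_)
    exact norm_conjMultilinear_le _
  · have hy' : star y ∈ Metric.eball (0 : E) r := by
      simpa [edist_eq_enorm_sub, enorm_eq_nnnorm] using hy
    have := (hp.hasSum hy').star
    rw [zero_add] at this ⊢
    exact this

end StarConj

theorem AnalyticAt.conj_comp_conjPt {u : ℂ × ℂ → ℂ} (hu : AnalyticAt ℂ u 0) :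
    AnalyticAt ℂ (fun z => starRingEnd ℂ (u (conjPt z))) 0 :=
  hu.star_comp_star

theorem conjPt_conjPt (z : ℂ × ℂ) : conjPt (conjPt z) = z := by simp [conjPt]

theorem continuous_conjPt : Continuous conjPt := by unfold conjPt; fun_prop

@[simp] theorem conjPt_zero : conjPt 0 = 0 := by simp [conjPt]

theorem tendsto_conjPt : Tendsto conjPt (𝓝 0) (𝓝 0) := by
  simpa using continuous_conjPt.tendsto 0

theorem continuous_toComplexPt : Continuous toComplexPt := by unfold toComplexPt; fun_prop

@[simp] theorem toComplexPt_zero : toComplexPt 0 = 0 := by simp [toComplexPt]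

theorem tendsto_toComplexPt : Tendsto toComplexPt (𝓝 0) (𝓝 0) := by
  simpa using continuous_toComplexPt.tendsto 0

theorem conjPt_toComplexPt (p : ℝ × ℝ) : conjPt (toComplexPt p) = toComplexPt p := by
  simp [conjPt, toComplexPt]

theorem eq_toComplexPt_of_conjPt_eq {z : ℂ × ℂ} (h : conjPt z = z) :
    z = toComplexPt (z.1.re, z.2.re) := by
  have h1 : starRingEnd ℂ z.1 = z.1 := congrArg Prod.fst h
  have h2 : starRingEnd ℂ z.2 = z.2 := congrArg Prod.snd h
  exact Prod.ext (Complex.conj_eq_iff_re.1 h1).symm (Complex.conj_eq_iff_re.1 h2).symm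

/-! ### Local coordinates and their replacement by real ones -/

/-- `(u, v)` is a system of local holomorphic coordinates of `ℂ²` centred at the origin. -/
structure IsCoordinates (u v : ℂ × ℂ → ℂ) : Prop where
  an_fst : AnalyticAt ℂ u 0
  an_snd : AnalyticAt ℂ v 0
  zero_fst : u 0 = 0
  zero_snd : v 0 = 0
  indep : LinearIndependent ℂ ![fderiv ℂ u 0, fderiv ℂ v 0]

namespace IsCoordinates

variable {u v : ℂ × ℂ → ℂ}

theorem swap (h : IsCoordinates u v) : IsCoordinates v u where
  an_fst := h.an_snd
  an_snd := h.an_fst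
  zero_fst := h.zero_snd
  zero_snd := h.zero_fst
  indep := LinearIndependent.pair_symm_iff.1 h.indep

theorem exists_inverse (h : IsCoordinates u v) :
    ∃ Ψ : ℂ × ℂ → ℂ × ℂ, AnalyticAt ℂ Ψ 0 ∧ Ψ 0 = 0 ∧
      (∀ᶠ w in 𝓝 0, u (Ψ w) = w.1 ∧ v (Ψ w) = w.2) ∧ ∀ᶠ z in 𝓝 0, Ψ (u z, v z) = z := by
  set Φ : ℂ × ℂ → ℂ × ℂ := fun z => (u z, v z)
  have hΦ : AnalyticAt ℂ Φ 0 := h.an_fst.prod h.an_snd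
  have hΦ0 : Φ 0 = 0 := Prod.ext h.zero_fst h.zero_snd
  set L : ℂ × ℂ →L[ℂ] ℂ × ℂ := (fderiv ℂ u 0).prod (fderiv ℂ v 0)
  have hL : HasStrictFDerivAt Φ L 0 :=
    h.an_fst.hasStrictFDerivAt.prodMk h.an_snd.hasStrictFDerivAt
  have hinj : Function.Injective (L : ℂ × ℂ →ₗ[ℂ] ℂ × ℂ) := by
    rw [← LinearMap.ker_eq_bot, LinearMap.ker_eq_bot']
    intro w hw
    have hw1 : fderiv ℂ u 0 w = 0 := congrArg Prod.fst hw
    have hw2 : fderiv ℂ v 0 w = 0 := congrArg Prod.snd hw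
    -- Two independent functionals span the dual plane, so a vector killed by both is killed by the
    -- two projections.
    have hspan : Submodule.span ℂ (Set.range ![fderiv ℂ u 0, fderiv ℂ v 0]) = ⊤ := by
      refine h.indep.span_eq_top_of_card_eq_finrank' ?_
      have e : (ℂ × ℂ →L[ℂ] ℂ) ≃ₗ[ℂ] (ℂ × ℂ →ₗ[ℂ] ℂ) := LinearMap.toContinuousLinearMap.symm
      rw [e.finrank_eq, Module.finrank_linearMap]
      simp
    have key : ∀ φ : ℂ × ℂ →L[ℂ] ℂ, φ w = 0 := by
      intro φ
      have : φ ∈ Submodule.span ℂ (Set.range ![fderiv ℂ u 0, fderiv ℂ v 0]) :=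
        hspan ▸ Submodule.mem_top
      induction this using Submodule.span_induction with
      | mem x hx =>
        obtain ⟨i, rfl⟩ := hx
        fin_cases i
        · exact hw1
        · exact hw2
      | zero => rfl
      | add x y _ _ hx hy => simp [hx, hy]
      | smul a x _ hx => simp [hx]
    exact Prod.ext (key (ContinuousLinearMap.fst ℂ ℂ ℂ)) (key (ContinuousLinearMap.snd ℂ ℂ ℂ))
  set e : (ℂ × ℂ) ≃L[ℂ] ℂ × ℂ :=
    (LinearEquiv.ofInjectiveEndo (L : ℂ × ℂ →ₗ[ℂ] ℂ × ℂ) hinj).toContinuousLinearEquiv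
  have he : (e : ℂ × ℂ →L[ℂ] ℂ × ℂ) = L := by ext <;> rfl
  have hS : HasStrictFDerivAt Φ (e : ℂ × ℂ →L[ℂ] ℂ × ℂ) 0 := he ▸ hL
  set P := hS.toOpenPartialHomeomorph Φ
  have hPΦ : (P : ℂ × ℂ → ℂ × ℂ) = Φ := rfl
  have h0 : (0 : ℂ × ℂ) ∈ P.source := hS.mem_toOpenPartialHomeomorph_source
  have ht : (0 : ℂ × ℂ) ∈ P.target := by
    have := P.map_source h0
    rwa [hPΦ, hΦ0] at this
  have hs0 : P.symm 0 = 0 := by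
    have := P.left_inv h0
    rwa [hPΦ, hΦ0] at this
  refine ⟨P.symm, ?_, hs0, ?_, ?_⟩
  · have := P.analyticAt_symm' (i := e) h0 hΦ hS.hasFDerivAt.fderiv
    rwa [hPΦ, hΦ0] at this
  · filter_upwards [P.open_target.mem_nhds ht] with w hw
    have := P.right_inv hw
    exact ⟨congrArg Prod.fst this, congrArg Prod.snd this⟩
  · filter_upwards [P.open_source.mem_nhds h0] with z hz
    exact P.left_inv hz

end IsCoordinates

namespace IsCoordinates

variable {u v : ℂ × ℂ → ℂ}

theorem tendsto_pair (h : IsCoordinates u v) :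
    Tendsto (fun z => (u z, v z)) (𝓝 0) (𝓝 0) := by
  have := (h.an_fst.continuousAt.prodMk h.an_snd.continuousAt).tendsto
  rwa [h.zero_fst, h.zero_snd] at this

/-- In the coordinates $(u,v)$, vanishing on the axis $u=0$ forces $dU=\mu\,du$. Strict
differentiability then gives $U=\mu u+o(u)$, with no need to divide by $u$. -/
theorem isTheta_of_zero_imp (h : IsCoordinates u v) {U : ℂ × ℂ → ℂ} (hU : AnalyticAt ℂ U 0)
    (hz : ∀ᶠ z in 𝓝 0, u z = 0 → U z = 0) (hd : fderiv ℂ U 0 ≠ 0) :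
    (∃ μ : ℂ, μ ≠ 0 ∧ fderiv ℂ U 0 = μ • fderiv ℂ u 0) ∧ U =Θ[𝓝 0] u := by
  obtain ⟨Ψ, hΨ, hΨ0, hr, hl⟩ := h.exists_inverse
  set G : ℂ × ℂ → ℂ := fun w => U (Ψ w)
  have hG : AnalyticAt ℂ G 0 := AnalyticAt.fun_comp (by rwa [hΨ0]) hΨ
  have hΨt : Tendsto Ψ (𝓝 0) (𝓝 0) := by simpa [hΨ0] using hΨ.continuousAt.tendsto
  have hG0 : ∀ᶠ w in 𝓝 (0 : ℂ × ℂ), w.1 = 0 → G w = 0 := by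
    filter_upwards [hr, hΨt.eventually hz] with w h1 h2 h3
    exact h2 (h1.1.trans h3)
  have hUG : U =ᶠ[𝓝 0] fun z => G (u z, v z) := by
    filter_upwards [hl] with z hz
    simp only [G, hz]
  have h0 : ((u 0, v 0) : ℂ × ℂ) = 0 := Prod.ext h.zero_fst h.zero_snd
  set L := fderiv ℂ G 0
  have hLU : fderiv ℂ U 0 = L.comp ((fderiv ℂ u 0).prod (fderiv ℂ v 0)) := by
    rw [hUG.fderiv_eq]
    have h1 : HasFDerivAt G L (u 0, v 0) := by rw [h0]; exact hG.differentiableAt.hasFDerivAt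
    exact (h1.comp (0 : ℂ × ℂ) (h.an_fst.differentiableAt.hasFDerivAt.prodMk
      h.an_snd.differentiableAt.hasFDerivAt)).fderiv
  have hL2 : L (0, 1) = 0 := by
    have h1 : HasDerivAt (fun t : ℂ => ((0 : ℂ), t)) (0, 1) 0 :=
      (hasDerivAt_const _ _).prodMk (hasDerivAt_id _)
    have h2 : HasDerivAt (fun t : ℂ => G (0, t)) (L (0, 1)) 0 :=
      (hG.differentiableAt.hasFDerivAt (x := (0 : ℂ × ℂ))).comp_hasDerivAt (0 : ℂ) h1
    have h3 : (fun t : ℂ => G (0, t)) =ᶠ[𝓝 0] fun _ => 0 := by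
      have : Tendsto (fun t : ℂ => ((0 : ℂ), t)) (𝓝 0) (𝓝 0) := by
        have : Continuous fun t : ℂ => ((0 : ℂ), t) := by fun_prop
        exact this.tendsto 0
      filter_upwards [this.eventually hG0] with t ht
      exact ht rfl
    exact h2.unique ((hasDerivAt_const _ _).congr_of_eventuallyEq h3)
  have hL (s t : ℂ) : L (s, t) = L (1, 0) * s := by
    have : ((s, t) : ℂ × ℂ) = s • ((1 : ℂ), (0 : ℂ)) + t • ((0 : ℂ), (1 : ℂ)) := by simp
    rw [this, map_add, map_smul, map_smul, hL2, smul_zero, add_zero, smul_eq_mul, mul_comm]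
  have hdU : fderiv ℂ U 0 = L (1, 0) • fderiv ℂ u 0 := by
    rw [hLU]
    refine ContinuousLinearMap.ext fun w => ?_
    simp [hL _ (fderiv ℂ v 0 w)]
  have hμ : L (1, 0) ≠ 0 := fun h => hd (by rw [hdU, h]; ext <;> simp)
  refine ⟨⟨_, hμ, hdU⟩, ?_⟩
  -- Comparing $(u,v)$ with $(0,v)$ makes the error small relative to $|u|$ alone.
  have ht : Tendsto (fun z => ((u z, v z), ((0 : ℂ), v z))) (𝓝 0) (𝓝 ((0, 0) : (ℂ × ℂ) × ℂ × ℂ)) := by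
    have h1 := h.tendsto_pair
    have h2 : Tendsto (fun z => ((0 : ℂ), v z)) (𝓝 0) (𝓝 (0 : ℂ × ℂ)) := by
      have h2 := h.an_snd.continuousAt.tendsto
      rw [h.zero_snd] at h2
      exact tendsto_const_nhds.prodMk_nhds h2
    exact h1.prodMk_nhds h2
  have hlo : (fun z => U z - L (1, 0) * u z) =o[𝓝 0] u := by
    refine ((hG.hasStrictFDerivAt.isLittleO.comp_tendsto ht).congr' ?_ EventuallyEq.rfl).trans_isBigO
      ?_
    · filter_upwards [hUG, (continuous_snd.tendsto _).comp ht |>.eventually hG0] with z h1 h2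
      simp only [Function.comp, h1]
      have h2 : G (0, v z) = 0 := h2 rfl
      change G (u z, v z) - G (0, v z) - L ((u z, v z) - (0, v z)) = _
      rw [h2, sub_zero, Prod.mk_sub_mk, hL, sub_zero]
    · refine Asymptotics.IsBigO.of_bound 1 (Eventually.of_forall fun z => ?_)
      simp [Prod.norm_def]
  have heq : Asymptotics.IsEquivalent (𝓝 0) U (fun z => L (1, 0) * u z) :=
    (Asymptotics.isLittleO_const_mul_right_iff hμ).2 hlo
  exact heq.isTheta.trans ((Asymptotics.isTheta_const_mul_left hμ).2 (Asymptotics.isTheta_refl _ _))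

theorem smul_fst (h : IsCoordinates u v) {U : ℂ × ℂ → ℂ} (hU : AnalyticAt ℂ U 0) (h0 : U 0 = 0)
    {μ : ℂ} (hμ : μ ≠ 0) (hd : fderiv ℂ U 0 = μ • fderiv ℂ u 0) : IsCoordinates U v where
  an_fst := hU
  an_snd := h.an_snd
  zero_fst := h0
  zero_snd := h.zero_snd
  indep := by
    have := LinearIndependent.pair_iff.1 h.indep
    refine LinearIndependent.pair_iff.2 fun s t hst => ?_
    rw [hd, smul_smul] at hst
    have := this _ _ hst
    exact ⟨(mul_eq_zero.1 this.1).resolve_right hμ, this.2⟩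

theorem fderiv_fst_ne_zero (h : IsCoordinates u v) : fderiv ℂ u 0 ≠ 0 := by
  simpa using h.indep.ne_zero 0

/-- A coordinate whose zero curve is invariant under conjugation can be replaced by a real one. -/
theorem exists_real_fst (h : IsCoordinates u v)
    (hc : ∀ᶠ z in 𝓝 0, u z = 0 → u (conjPt z) = 0) :
    ∃ U, IsCoordinates U v ∧ (∀ z, U (conjPt z) = starRingEnd ℂ (U z)) ∧ U =Θ[𝓝 0] u := by
  set u' : ℂ × ℂ → ℂ := fun z => starRingEnd ℂ (u (conjPt z))
  have hu' : AnalyticAt ℂ u' 0 := h.an_fst.conj_comp_conjPt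
  have hu'0 : u' 0 = 0 := by simp [u', h.zero_fst]
  have hu'z : ∀ᶠ z in 𝓝 0, u z = 0 → u' z = 0 := by
    filter_upwards [hc] with z hz h
    simp [u', hz h]
  suffices ∃ U, AnalyticAt ℂ U 0 ∧ U 0 = 0 ∧ (∀ z, U (conjPt z) = starRingEnd ℂ (U z)) ∧
      (∀ᶠ z in 𝓝 0, u z = 0 → U z = 0) ∧ fderiv ℂ U 0 ≠ 0 by
    obtain ⟨U, hU, hU0, hUr, hUz, hUd⟩ := this
    obtain ⟨⟨μ, hμ, hd⟩, hθ⟩ := h.isTheta_of_zero_imp hU hUz hUd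
    exact ⟨U, h.smul_fst hU hU0 hμ hd, hUr, hθ⟩
  have hdu := h.an_fst.differentiableAt
  have hdu' := hu'.differentiableAt
  -- Both $u+u'$ and $i(u-u')$ are real and vanish on $u=0$. If the first has zero differential, the
  -- second has differential $2i\,du\ne0$.
  by_cases hd : fderiv ℂ (fun z => u z + u' z) 0 = 0
  · refine ⟨fun z => Complex.I * (u z - u' z), analyticAt_const.mul (h.an_fst.sub hu'), ?_, ?_, ?_,
      ?_⟩
    · simp [h.zero_fst, hu'0]
    · intro z
      simp only [u', conjPt_conjPt, map_mul, map_sub, Complex.conj_I, Complex.conj_conj]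
      ring
    · filter_upwards [hu'z] with z hz h
      simp [h, hz h]
    · rw [fderiv_const_mul (hdu.fun_sub hdu'), fderiv_fun_sub hdu hdu']
      rw [fderiv_fun_add hdu hdu'] at hd
      rw [eq_neg_of_add_eq_zero_right hd, sub_neg_eq_add, ← two_smul ℂ, smul_smul]
      exact smul_ne_zero (by simp) h.fderiv_fst_ne_zero
  · refine ⟨fun z => u z + u' z, h.an_fst.add hu', ?_, ?_, ?_, hd⟩
    · simp [h.zero_fst, hu'0]
    · intro z
      simp only [u', conjPt_conjPt, map_add, Complex.conj_conj]
      ring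
    · filter_upwards [hu'z] with z hz h
      simp [h, hz h]

theorem exists_real_snd (h : IsCoordinates u v) :
    ∃ V, IsCoordinates u V ∧ ∀ z, V (conjPt z) = starRingEnd ℂ (V z) := by
  by_cases h1 : LinearIndependent ℂ ![fderiv ℂ u 0, ContinuousLinearMap.fst ℂ ℂ ℂ]
  · exact ⟨Prod.fst, ⟨h.an_fst, analyticAt_fst, h.zero_fst, rfl, by rwa [fderiv_fst]⟩, fun z => rfl⟩
  by_cases h2 : LinearIndependent ℂ ![fderiv ℂ u 0, ContinuousLinearMap.snd ℂ ℂ ℂ]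
  · exact ⟨Prod.snd, ⟨h.an_fst, analyticAt_snd, h.zero_fst, rfl, by rwa [fderiv_snd]⟩, fun z => rfl⟩
  exfalso
  rw [LinearIndependent.pair_iff' h.fderiv_fst_ne_zero] at h1 h2
  push Not at h1 h2
  obtain ⟨a, ha⟩ := h1
  obtain ⟨b, hb⟩ := h2
  have e1 : a * fderiv ℂ u 0 (1, 0) = 1 := by simpa using DFunLike.congr_fun ha ((1 : ℂ), (0 : ℂ))
  have e2 : a * fderiv ℂ u 0 (0, 1) = 0 := by simpa using DFunLike.congr_fun ha ((0 : ℂ), (1 : ℂ))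
  have e3 : b * fderiv ℂ u 0 (0, 1) = 1 := by simpa using DFunLike.congr_fun hb ((0 : ℂ), (1 : ℂ))
  rcases mul_eq_zero.1 e2 with h | h
  · simp [h] at e1
  · simp [h] at e3

/-- Bounds by a monomial in real coordinates extend from real to complex points. -/
theorem isBigO_of_real (h : IsCoordinates u v) (hu : ∀ z, u (conjPt z) = starRingEnd ℂ (u z))
    (hv : ∀ z, v (conjPt z) = starRingEnd ℂ (v z)) {F : ℂ × ℂ → ℂ} (hF : AnalyticAt ℂ F 0)
    {a b : ℕ}
    (hO : (fun p => F (toComplexPt p)) =O[𝓝 0]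
      fun p => u (toComplexPt p) ^ a * v (toComplexPt p) ^ b) :
    F =O[𝓝 0] fun z => u z ^ a * v z ^ b := by
  obtain ⟨Ψ, hΨ, hΨ0, hr, hl⟩ := h.exists_inverse
  have hΨt : Tendsto Ψ (𝓝 0) (𝓝 0) := by simpa [hΨ0] using hΨ.continuousAt.tendsto
  -- The inverse of a real coordinate change sends real points to real points, where the hypothesis
  -- applies.
  have hconj : ∀ᶠ w in 𝓝 0, conjPt w = w → conjPt (Ψ w) = Ψ w := by
    filter_upwards [hr, (tendsto_conjPt.comp hΨt).eventually hl] with w h1 h2 h3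
    rw [Function.comp, hu, hv, h1.1, h1.2] at h2
    exact h2.symm.trans (congrArg Ψ h3)
  set ρ : ℝ × ℝ → ℝ × ℝ := fun p => ((Ψ (toComplexPt p)).1.re, (Ψ (toComplexPt p)).2.re)
  have hρ : Tendsto ρ (𝓝 0) (𝓝 0) := by
    have : Continuous fun z : ℂ × ℂ => (z.1.re, z.2.re) := by fun_prop
    exact (this.tendsto' 0 0 (by simp)).comp (hΨt.comp tendsto_toComplexPt)
  have hρΨ : ∀ᶠ p in 𝓝 0, toComplexPt (ρ p) = Ψ (toComplexPt p) := by
    filter_upwards [tendsto_toComplexPt.eventually hconj] with p hp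
    exact (eq_toComplexPt_of_conjPt_eq (hp (conjPt_toComplexPt p))).symm
  have key : (fun w => F (Ψ w)) =O[𝓝 0] fun w : ℂ × ℂ => w.1 ^ a * w.2 ^ b := by
    refine isBigO_monomial_of_real (AnalyticAt.fun_comp (by rwa [hΨ0]) hΨ) ?_
    refine Asymptotics.IsBigO.of_norm_right (((hO.comp_tendsto hρ).norm_right).congr' ?_ ?_)
    · filter_upwards [hρΨ] with p hp
      simp [hp]
    · filter_upwards [hρΨ, tendsto_toComplexPt.eventually hr] with p hp h1
      simp only [Function.comp, hp, h1.1, h1.2]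
      simp [toComplexPt]
  refine (key.comp_tendsto h.tendsto_pair).congr' ?_ EventuallyEq.rfl
  filter_upwards [hl] with z hz
  simp [hz]

/-- A coordinate with exponent $0$ does not enter the monomial, so any real complement may replace
it; invariance matters only for positive exponents. -/
theorem exists_real (h : IsCoordinates u v) {a b : ℕ}
    (ha : a ≠ 0 → ∀ᶠ z in 𝓝 0, u z = 0 → u (conjPt z) = 0)
    (hb : b ≠ 0 → ∀ᶠ z in 𝓝 0, v z = 0 → v (conjPt z) = 0) :
    ∃ U V, IsCoordinates U V ∧ (∀ z, U (conjPt z) = starRingEnd ℂ (U z)) ∧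
      (∀ z, V (conjPt z) = starRingEnd ℂ (V z)) ∧
      (fun z => U z ^ a * V z ^ b) =Θ[𝓝 0] fun z => u z ^ a * v z ^ b := by
  rcases eq_or_ne a 0 with rfl | ha'
  · rcases eq_or_ne b 0 with rfl | hb'
    · refine ⟨Prod.fst, Prod.snd, ⟨analyticAt_fst, analyticAt_snd, rfl, rfl, ?_⟩, fun z => rfl,
        fun z => rfl, by simp⟩
      rw [fderiv_fst, fderiv_snd, LinearIndependent.pair_iff]
      intro s t hst
      exact ⟨by simpa using DFunLike.congr_fun hst ((1 : ℂ), (0 : ℂ)),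
        by simpa using DFunLike.congr_fun hst ((0 : ℂ), (1 : ℂ))⟩
    · obtain ⟨V, hV, hVr, hVθ⟩ := h.swap.exists_real_fst (hb hb')
      obtain ⟨U, hU, hUr⟩ := hV.exists_real_snd
      exact ⟨U, V, hU.swap, hUr, hVr, by simpa using hVθ.pow b⟩
  · obtain ⟨U, hU, hUr, hUθ⟩ := h.exists_real_fst (ha ha')
    rcases eq_or_ne b 0 with rfl | hb'
    · obtain ⟨V, hV, hVr⟩ := hU.exists_real_snd
      exact ⟨U, V, hV, hUr, hVr, by simpa using hUθ.pow a⟩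
    · obtain ⟨V, hV, hVr, hVθ⟩ := hU.swap.exists_real_fst (hb hb')
      exact ⟨U, V, hV.swap, hUr, hVr, (hUθ.pow a).mul (hVθ.pow b)⟩

end IsCoordinates

/-! ### Monomial ideals: the case without blow-ups -/

theorem IsMonomialAtOrigin.exists_coordinates {m : ℕ} {G : Fin m → ℂ × ℂ → ℂ}
    (hG : IsMonomialAtOrigin G) : ∃ (u v : ℂ × ℂ → ℂ) (a b : ℕ), IsCoordinates u v ∧
      (fun z => u z ^ a * v z ^ b) =Θ[𝓝 0] fun z => ∑ i, ‖G i z‖ := by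
  obtain ⟨u, v, a, b, hu, hv, hu0, hv0, hind, hle, c, hc, hge⟩ := hG
  refine ⟨u, v, a, b, ⟨hu, hv, hu0, hv0, hind⟩, ?_, ?_⟩
  · refine EventuallyEq.trans_isBigO hge (Asymptotics.IsBigO.fun_sum fun i _ => ?_)
    have h1 : G i =O[𝓝 0] fun z => ∑ i, ‖G i z‖ := by
      refine Asymptotics.IsBigO.of_bound 1 (Eventually.of_forall fun z => ?_)
      rw [one_mul, Real.norm_of_nonneg (Finset.sum_nonneg fun i _ => norm_nonneg _)]
      exact Finset.single_le_sum (f := fun i => ‖G i z‖) (fun i _ => norm_nonneg _)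
        (Finset.mem_univ i)
    simpa using ((hc i).continuousAt.tendsto.isBigO_one ℝ).mul h1
  · refine Asymptotics.IsBigO.fun_sum fun i _ => ?_
    obtain ⟨h, hh, heq⟩ := hle i
    refine Asymptotics.IsBigO.norm_left (EventuallyEq.trans_isBigO heq ?_)
    simpa using (hh.continuousAt.tendsto.isBigO_one ℂ).mul
      (Asymptotics.isBigO_refl (fun z => u z ^ a * v z ^ b) (𝓝 0))

/-- The arc $t\mapsto\Psi(0,t)$, with $\Psi$ the inverse chart, runs through all zeros of $u$ near
the origin. It lets the hypothesis on branches, stated for arcs, be applied to the curve $u=0$. -/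
theorem IsCoordinates.exists_curve {u v : ℂ × ℂ → ℂ} (h : IsCoordinates u v) :
    ∃ γ : ℂ → ℂ × ℂ, AnalyticAt ℂ γ 0 ∧ γ 0 = 0 ∧ (∀ᶠ t in 𝓝 0, u (γ t) = 0) ∧
      ∀ Q : ℂ × ℂ → Prop, (∀ᶠ t in 𝓝 0, Q (γ t)) → ∀ᶠ z in 𝓝 0, u z = 0 → Q z := by
  obtain ⟨Ψ, hΨ, hΨ0, hr, hl⟩ := h.exists_inverse
  have ht : Tendsto (fun t : ℂ => ((0 : ℂ), t)) (𝓝 0) (𝓝 0) := by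
    have : Continuous fun t : ℂ => ((0 : ℂ), t) := by fun_prop
    exact this.tendsto 0
  refine ⟨fun t => Ψ (0, t), AnalyticAt.fun_comp (f := fun t : ℂ => ((0 : ℂ), t)) hΨ (by fun_prop),
    hΨ0, ?_, fun Q hQ => ?_⟩
  · filter_upwards [ht.eventually hr] with t h using h.1
  · have hv : Tendsto v (𝓝 0) (𝓝 0) := by simpa [h.zero_snd] using h.an_snd.continuousAt.tendsto
    filter_upwards [hl, hv.eventually hQ] with z h1 h2 h3
    rw [h3] at h1
    rwa [h1] at h2

section Branches

variable {m : ℕ} {g : Fin m → ℂ × ℂ → ℂ}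

theorem ZeroCurveHasRealBranches.conj_zero (hreal : ZeroCurveHasRealBranches g)
    {u v : ℂ × ℂ → ℂ} (h : IsCoordinates u v) (hz : ∀ᶠ z in 𝓝 0, u z = 0 → ∀ i, g i z = 0) :
    ∀ᶠ z in 𝓝 0, u z = 0 → u (conjPt z) = 0 := by
  obtain ⟨γ, hγ, hγ0, hγu, hQ⟩ := h.exists_curve
  refine hQ _ ?_
  have hγt : Tendsto γ (𝓝 0) (𝓝 0) := by simpa [hγ0] using hγ.continuousAt.tendsto
  have hγz : ∀ᶠ t in 𝓝 0, ∀ i, g i (γ t) = 0 := by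
    filter_upwards [hγu, hγt.eventually hz] with t h1 h2 using h2 h1
  -- The neighbourhood fed to the branch hypothesis is the set of $t$ with $u(\gamma(t))=0$.
  filter_upwards [hreal γ hγ hγ0 hγz _ hγu] with t ht
  obtain ⟨s, hs, hst⟩ := ht
  rw [← hst]
  exact hs

theorem zero_of_isTheta {u v : ℂ × ℂ → ℂ} {a b : ℕ}
    (hθ : (fun z => u z ^ a * v z ^ b) =Θ[𝓝 0] fun z => ∑ i, ‖g i z‖) :
    ∀ᶠ z in 𝓝 0, u z ^ a * v z ^ b = 0 → ∀ i, g i z = 0 := by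
  filter_upwards [hθ.isBigO_symm.eq_zero_imp] with z hz h i
  have := (Finset.sum_eq_zero_iff_of_nonneg fun i _ => norm_nonneg _).1 (hz h) i (Finset.mem_univ i)
  simpa using this

theorem isBigO_of_isMonomialAtOrigin (hg : IsMonomialAtOrigin g)
    (hreal : ZeroCurveHasRealBranches g) {f : ℂ × ℂ → ℂ} (hf : AnalyticAt ℂ f 0)
    (h : (fun p => f (toComplexPt p)) =O[𝓝 0] fun p => ∑ i, ‖g i (toComplexPt p)‖) :
    f =O[𝓝 0] fun z => ∑ i, ‖g i z‖ := by
  obtain ⟨u, v, a, b, huv, hθ⟩ := hg.exists_coordinates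
  have hzero := zero_of_isTheta hθ
  obtain ⟨U, V, hUV, hU, hV, hθ'⟩ := huv.exists_real (a := a) (b := b)
    (fun ha => hreal.conj_zero huv (by
      filter_upwards [hzero] with z hz h
      exact hz (by simp [h, ha])))
    (fun hb => hreal.conj_zero huv.swap (by
      filter_upwards [hzero] with z hz h
      exact hz (by simp [h, hb])))
  have hθ'' := hθ'.trans hθ
  refine (hUV.isBigO_of_real hU hV hf (h.trans ?_)).trans hθ''.1
  exact hθ''.2.comp_tendsto tendsto_toComplexPt

end Branches

/-! ### Lifting the hypotheses to the points of the exceptional curve -/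

section Charts

theorem analyticAt_directionChart (d : OnePoint ℂ) (z : ℂ × ℂ) :
    AnalyticAt ℂ (directionChart d) z := by
  cases d with
  | infty => exact (analyticAt_fst.mul analyticAt_snd).prod analyticAt_snd
  | coe c => exact analyticAt_fst.prod (analyticAt_fst.mul (analyticAt_snd.add analyticAt_const))

@[simp] theorem directionChart_zero (d : OnePoint ℂ) : directionChart d 0 = 0 := by
  cases d <;> simp [directionChart]

theorem tendsto_directionChart (d : OnePoint ℂ) : Tendsto (directionChart d) (𝓝 0) (𝓝 0) := by
  simpa using (analyticAt_directionChart d 0).continuousAt.tendsto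

theorem AnalyticAt.comp_directionChart {f : ℂ × ℂ → ℂ} (hf : AnalyticAt ℂ f 0) (d : OnePoint ℂ) :
    AnalyticAt ℂ (f ∘ directionChart d) 0 :=
  AnalyticAt.comp (by simpa using hf) (analyticAt_directionChart d 0)

theorem IsRealDirection.conj_chart {d : OnePoint ℂ} (hd : IsRealDirection d) (z : ℂ × ℂ) :
    directionChart d (conjPt z) = conjPt (directionChart d z) := by
  obtain rfl | ⟨c, rfl⟩ := hd
  · change (_ * _, _) = conjPt (_ * _, _)
    simp [conjPt]
  · change (_, _ * (_ + (c : ℂ))) = conjPt (_, _ * (_ + (c : ℂ)))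
    simp [conjPt]

theorem directionChart_injOn {d : OnePoint ℂ} {z w : ℂ × ℂ} (hz : directionChart d z ≠ 0)
    (h : directionChart d z = directionChart d w) : z = w := by
  cases d with
  | infty =>
    change ((z.1 * z.2, z.2) : ℂ × ℂ) = (w.1 * w.2, w.2) at h
    change ((z.1 * z.2, z.2) : ℂ × ℂ) ≠ 0 at hz
    rw [Prod.mk.injEq] at h
    have h2 : z.2 ≠ 0 := fun h0 => hz (by simp [h0])
    refine Prod.ext (mul_right_cancel₀ h2 ?_) h.2
    rw [h.1, h.2]
  | coe c =>
    change ((z.1, z.1 * (z.2 + c)) : ℂ × ℂ) = (w.1, w.1 * (w.2 + c)) at h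
    change ((z.1, z.1 * (z.2 + c)) : ℂ × ℂ) ≠ 0 at hz
    rw [Prod.mk.injEq] at h
    have h1 : z.1 ≠ 0 := fun h0 => hz (by simp [h0])
    refine Prod.ext h.1 ?_
    rw [← h.1] at h
    exact add_right_cancel (mul_left_cancel₀ h1 h.2)

/-- A germ of an analytic arc inside a line whose image under a direction chart is constant is
invariant under conjugation. -/
theorem conjPt_mem_image_of_chart_eq_zero {d : OnePoint ℂ} {γ : ℂ → ℂ × ℂ} (hγ : AnalyticAt ℂ γ 0)
    (hγ0 : γ 0 = 0) (h : ∀ᶠ t in 𝓝 0, directionChart d (γ t) = 0) {V : Set ℂ} (hV : V ∈ 𝓝 0) :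
    ∀ᶠ t in 𝓝 0, conjPt (γ t) ∈ γ '' V := by
  -- The arc lies in the exceptional line, parametrized by a real map $\iota$. Its parameter
  -- $\varphi$ is constant or open at $0$, and in the open case it also takes the value
  -- $\overline{\varphi(t)}$.
  have key : ∀ (φ : ℂ → ℂ) (ι : ℂ → ℂ × ℂ), AnalyticAt ℂ φ 0 → φ 0 = 0 →
      (∀ c, conjPt (ι c) = ι (starRingEnd ℂ c)) → (∀ᶠ t in 𝓝 0, γ t = ι (φ t)) →
      ∀ᶠ t in 𝓝 0, conjPt (γ t) ∈ γ '' V := by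
    intro φ ι hφ hφ0 hι heq
    rcases hφ.eventually_constant_or_nhds_le_map_nhds with hc | hop
    · filter_upwards [hc, heq] with t h1 h2
      refine ⟨0, mem_of_mem_nhds hV, ?_⟩
      rw [h2, h1, hφ0, hι, map_zero, heq.self_of_nhds, hφ0]
    · rw [hφ0] at hop
      have him : φ '' (V ∩ {t | γ t = ι (φ t)}) ∈ 𝓝 0 := hop (image_mem_map (inter_mem hV heq))
      have hct : Tendsto (fun t => starRingEnd ℂ (φ t)) (𝓝 0) (𝓝 0) := by
        have := (Complex.continuous_conj.tendsto (φ 0)).comp hφ.continuousAt.tendsto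
        rwa [hφ0, map_zero] at this
      filter_upwards [heq, hct him] with t h1 h2
      obtain ⟨s, ⟨hsV, hs⟩, hst⟩ := h2
      refine ⟨s, hsV, ?_⟩
      exact (h1 ▸ hs.trans (by rw [hst, hι]) : γ s = conjPt (γ t))
  cases d with
  | infty =>
    refine key (fun t => (γ t).1) (fun c => (c, 0)) (analyticAt_fst.fun_comp hγ) (by simp [hγ0])
      (fun c => by simp [conjPt]) ?_
    filter_upwards [h] with t ht
    change ((γ t).1 * (γ t).2, (γ t).2) = (0 : ℂ × ℂ) at ht
    exact Prod.ext rfl (congrArg Prod.snd ht :)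
  | coe c =>
    refine key (fun t => (γ t).2) (fun c => (0, c)) (analyticAt_snd.fun_comp hγ) (by simp [hγ0])
      (fun c => by simp [conjPt]) ?_
    filter_upwards [h] with t ht
    change ((γ t).1, (γ t).1 * ((γ t).2 + c)) = (0 : ℂ × ℂ) at ht
    exact Prod.ext (congrArg Prod.fst ht :) rfl

variable {m : ℕ} {g : Fin m → ℂ × ℂ → ℂ}

/-- The image arc is invariant downstairs, and the chart commutes with conjugation and is injective
off the exceptional curve. Arcs inside that curve collapse to a point and need a separate argument.
-/
theorem ZeroCurveHasRealBranches.comp_directionChart (hreal : ZeroCurveHasRealBranches g)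
    {d : OnePoint ℂ} (hd : IsRealDirection d) :
    ZeroCurveHasRealBranches fun i => g i ∘ directionChart d := by
  intro γ hγ hγ0 hγz V hV
  have hχγ : AnalyticAt ℂ (fun t => directionChart d (γ t)) 0 :=
    (analyticAt_directionChart d _).fun_comp hγ
  rcases hχγ.eventually_eq_zero_or_eventually_ne_zero with h | h
  · exact conjPt_mem_image_of_chart_eq_zero hγ hγ0 h hV
  · have h1 := hreal _ hχγ (by simp [hγ0]) hγz V hV
    have h2 : ∀ᶠ t in 𝓝[≠] 0, conjPt (γ t) ∈ γ '' V := by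
      filter_upwards [nhdsWithin_le_nhds h1, h] with t h1 h2
      obtain ⟨s, hs, hst⟩ := h1
      refine ⟨s, hs, ?_⟩
      rw [← hd.conj_chart] at hst
      refine (directionChart_injOn (d := d) ?_ hst.symm).symm
      rw [hd.conj_chart]
      intro h0
      apply h2
      rw [← conjPt_conjPt (directionChart d (γ t)), h0, conjPt_zero]
    rw [eventually_nhdsWithin_iff] at h2
    filter_upwards [h2] with t ht
    by_cases h0 : t = 0
    · exact ⟨0, mem_of_mem_nhds hV, by simp [h0, hγ0]⟩
    · exact ht h0

theorem isBigO_real_comp_directionChart {f : ℂ × ℂ → ℂ} {d : OnePoint ℂ} (hd : IsRealDirection d)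
    (h : (fun p => f (toComplexPt p)) =O[𝓝 0] fun p => ∑ i, ‖g i (toComplexPt p)‖) :
    (fun p => (f ∘ directionChart d) (toComplexPt p)) =O[𝓝 0]
      fun p => ∑ i, ‖(g i ∘ directionChart d) (toComplexPt p)‖ := by
  set ρ : ℝ × ℝ → ℝ × ℝ := fun p =>
    ((directionChart d (toComplexPt p)).1.re, (directionChart d (toComplexPt p)).2.re)
  have hρ : Tendsto ρ (𝓝 0) (𝓝 0) := by
    have : Continuous fun z : ℂ × ℂ => (z.1.re, z.2.re) := by fun_prop
    exact (this.tendsto' 0 0 (by simp)).comp ((tendsto_directionChart d).comp tendsto_toComplexPt)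
  have hρd (p) : directionChart d (toComplexPt p) = toComplexPt (ρ p) :=
    eq_toComplexPt_of_conjPt_eq (by rw [← hd.conj_chart, conjPt_toComplexPt])
  simpa only [Function.comp_def, hρd] using h.comp_tendsto hρ

/-- At a non-real direction, a coordinate curve contained in the pulled back zero set is the
exceptional curve. -/
theorem ZeroCurveHasRealBranches.fst_eq_zero (hreal : ZeroCurveHasRealBranches g) {c : ℂ}
    (hc : c.im ≠ 0) {u v : ℂ × ℂ → ℂ} (h : IsCoordinates u v)
    (hz : ∀ᶠ z in 𝓝 0, u z = 0 → ∀ i, g i (directionChart (c : OnePoint ℂ) z) = 0) :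
    ∀ᶠ z in 𝓝 0, u z = 0 → z.1 = 0 := by
  obtain ⟨γ, hγ, hγ0, hγu, hQ⟩ := h.exists_curve
  refine hQ _ ?_
  refine ((analyticAt_fst.fun_comp hγ).eventually_eq_zero_or_eventually_ne_zero).resolve_right
    fun hne => ?_
  have hγt : Tendsto γ (𝓝 0) (𝓝 0) := by simpa [hγ0] using hγ.continuousAt.tendsto
  have hγz : ∀ᶠ t in 𝓝 0, ∀ i, g i (directionChart (c : OnePoint ℂ) (γ t)) = 0 := by
    filter_upwards [hγu, hγt.eventually hz] with t h1 h2 using h2 h1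
  -- Slopes on the image arc are $c+\gamma_2$. Matching one with the conjugate of another forces two
  -- values of $\mathrm{Im}\,\gamma_2$ to sum to $-2\,\mathrm{Im}\,c$, impossible once each is
  -- smaller than $|\mathrm{Im}\,c|$.
  have hsmall : ∀ᶠ t in 𝓝 0, |(γ t).2.im| < |c.im| := by
    have : Continuous fun z : ℂ × ℂ => |z.2.im| := by fun_prop
    have := (this.tendsto' 0 0 (by simp)).comp hγt
    exact this.eventually_lt_const (abs_pos.2 hc)
  have h1 := hreal (fun t => directionChart (c : OnePoint ℂ) (γ t))
    ((analyticAt_directionChart _ _).fun_comp hγ) (by simp [hγ0]) hγz _ hsmall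
  obtain ⟨t, ⟨s, hs, hst⟩, ht, hne⟩ :=
    ((h1.filter_mono nhdsWithin_le_nhds).and
      ((hsmall.filter_mono nhdsWithin_le_nhds).and hne)).exists
  change (((γ s).1, (γ s).1 * ((γ s).2 + c)) : ℂ × ℂ) =
    conjPt ((γ t).1, (γ t).1 * ((γ t).2 + c)) at hst
  simp only [conjPt, Prod.mk.injEq, map_mul] at hst
  rw [hst.1] at hst
  have h2 := mul_left_cancel₀ ((map_ne_zero _).2 hne) hst.2
  have h3 := congrArg Complex.im h2
  simp only [map_add, Complex.add_im, Complex.conj_im] at h3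
  have hs : |(γ s).2.im| < |c.im| := hs
  have h4 : |(γ s).2.im + (γ t).2.im| = 2 * |c.im| := by
    rw [show (γ s).2.im + (γ t).2.im = -(2 * c.im) by linarith, abs_neg, abs_mul, abs_two]
  linarith [abs_add_le (γ s).2.im (γ t).2.im]

theorem exists_isTheta_pow_of_nonreal (hreal : ZeroCurveHasRealBranches g) {c : ℂ}
    (hc : c.im ≠ 0) (hmon : IsMonomialAtOrigin fun i => g i ∘ directionChart (c : OnePoint ℂ)) :
    ∃ a : ℕ, (fun z : ℂ × ℂ => z.1 ^ a) =Θ[𝓝 0]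
      fun z => ∑ i, ‖g i (directionChart (c : OnePoint ℂ) z)‖ := by
  obtain ⟨u, v, a, b, huv, hθ⟩ := hmon.exists_coordinates
  have hzero := zero_of_isTheta hθ
  have hcmp : ∀ {u v : ℂ × ℂ → ℂ}, IsCoordinates u v →
      (∀ᶠ z in 𝓝 0, u z = 0 → ∀ i, g i (directionChart (c : OnePoint ℂ) z) = 0) →
      (∃ μ : ℂ, μ ≠ 0 ∧ ContinuousLinearMap.fst ℂ ℂ ℂ = μ • fderiv ℂ u 0) ∧
        Prod.fst =Θ[𝓝 0] u := by
    intro u v huv hz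
    have := huv.isTheta_of_zero_imp (U := Prod.fst) analyticAt_fst (hreal.fst_eq_zero hc huv hz)
      (by
        rw [fderiv_fst]
        intro h
        simpa using DFunLike.congr_fun h ((1 : ℂ), (0 : ℂ)))
    rwa [fderiv_fst] at this
  have hu (ha : a ≠ 0) := hcmp huv (by
    filter_upwards [hzero] with z hz h
    exact hz (by simp [h, ha]))
  have hv (hb : b ≠ 0) := hcmp huv.swap (by
    filter_upwards [hzero] with z hz h
    exact hz (by simp [h, hb]))
  rcases eq_or_ne a 0 with rfl | ha
  · rcases eq_or_ne b 0 with rfl | hb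
    · exact ⟨0, by simpa using hθ⟩
    · exact ⟨b, ((hv hb).2.pow b).trans (by simpa using hθ)⟩
  · rcases eq_or_ne b 0 with rfl | hb
    · exact ⟨a, ((hu ha).2.pow a).trans (by simpa using hθ)⟩
    -- If both exponents were positive, both $du$ and $dv$ would be proportional to $dx$, against
    -- independence.
    · obtain ⟨μ, hμ, h1⟩ := (hu ha).1
      obtain ⟨ν, hν, h2⟩ := (hv hb).1
      have := LinearIndependent.pair_iff.1 huv.indep μ (-ν) (by
        rw [← h1, neg_smul, ← h2, add_neg_cancel])
      exact absurd this.1 hμ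

/-- The information travels through the order at the origin: the local generator $x^a$ bounds the
order of each $g_i$ below by $a$, the real estimate passes this to $f$, and $\|z\|=O(x)$ in the
chart. -/
theorem isBigO_of_nonreal (hg : ∀ i, AnalyticAt ℂ (g i) 0) (hreal : ZeroCurveHasRealBranches g)
    {c : ℂ} (hc : c.im ≠ 0) (hmon : IsMonomialAtOrigin fun i => g i ∘ directionChart (c : OnePoint ℂ))
    {f : ℂ × ℂ → ℂ} (hf : AnalyticAt ℂ f 0)
    (h : (fun p => f (toComplexPt p)) =O[𝓝 0] fun p => ∑ i, ‖g i (toComplexPt p)‖) :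
    (f ∘ directionChart (c : OnePoint ℂ)) =O[𝓝 0] fun z => ∑ i, ‖g i (directionChart (c : OnePoint ℂ) z)‖ := by
  obtain ⟨a, hθ⟩ := exists_isTheta_pow_of_nonreal hreal hc hmon
  have hgO : ∀ i, g i =O[𝓝 0] fun z => ‖z‖ ^ a := by
    intro i
    have h1 : (g i ∘ directionChart (c : OnePoint ℂ)) =O[𝓝 0] fun z => z.1 ^ a := by
      refine Asymptotics.IsBigO.trans (Asymptotics.IsBigO.of_bound 1 ?_) hθ.2
      refine Eventually.of_forall fun z => ?_
      rw [one_mul, Real.norm_of_nonneg (Finset.sum_nonneg fun i _ => norm_nonneg _)]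
      exact Finset.single_le_sum (f := fun i => ‖g i (directionChart (c : OnePoint ℂ) z)‖)
        (fun i _ => norm_nonneg _) (Finset.mem_univ i)
    obtain ⟨C, hC⟩ := h1.bound
    refine isBigO_norm_pow_of_cone (hg i) (w₀ := (1, c)) ?_
    -- The line through $w$ lifts to the chart line with second coordinate $w_2/w_1-c$, which is
    -- small for $w$ near $(1,c)$; so the chart sees an open cone of directions.
    have ht : Tendsto (fun w : ℂ × ℂ => ((0 : ℂ), w.2 / w.1 - c)) (𝓝 (1, c)) (𝓝 0) := by
      have : ContinuousAt (fun w : ℂ × ℂ => ((0 : ℂ), w.2 / w.1 - c)) (1, c) := by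
        refine continuousAt_const.prodMk ((continuousAt_snd.div continuousAt_fst ?_).sub
          continuousAt_const)
        simp
      rw [show (0 : ℂ × ℂ) = (0, (1, c).2 / (1, c).1 - c) by simp; rfl]
      exact this.tendsto
    have hne : ∀ᶠ w : ℂ × ℂ in 𝓝 (1, c), w.1 ≠ 0 :=
      continuousAt_fst.eventually_ne (by simp)
    filter_upwards [ht.eventually hC.eventually_nhds, hne] with w hw hw1
    have hτ : Tendsto (fun τ : ℝ => ((τ : ℂ) * w.1, w.2 / w.1 - c)) (𝓝 0)
        (𝓝 (0, w.2 / w.1 - c)) := by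
      have : Continuous fun τ : ℝ => ((τ : ℂ) * w.1, w.2 / w.1 - c) := by fun_prop
      simpa using this.tendsto 0
    refine Asymptotics.IsBigO.of_bound (C * ‖w.1‖ ^ a) ?_
    filter_upwards [hτ.eventually hw] with τ hτ
    have e : directionChart (c : OnePoint ℂ) ((τ : ℂ) * w.1, w.2 / w.1 - c) = (τ : ℂ) • w := by
      change ((τ : ℂ) * w.1, (τ : ℂ) * w.1 * (w.2 / w.1 - c + c)) = (τ : ℂ) • w
      refine Prod.ext rfl ?_
      change (τ : ℂ) * w.1 * (w.2 / w.1 - c + c) = (τ : ℂ) * w.2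
      field_simp
      ring
    rw [Function.comp, e] at hτ
    refine hτ.trans (le_of_eq ?_)
    simp [mul_pow]
    ring
  have hfO : f =O[𝓝 0] fun z => ‖z‖ ^ a := by
    refine isBigO_norm_pow_of_real hf (h.trans (Asymptotics.IsBigO.fun_sum fun i _ => ?_))
    refine (((hgO i).comp_tendsto tendsto_toComplexPt).norm_left).congr_right fun p => ?_
    simp [toComplexPt, Prod.norm_def]
  have hχ : (fun z => ‖directionChart (c : OnePoint ℂ) z‖) =O[𝓝 0] fun z : ℂ × ℂ => z.1 := by
    refine Asymptotics.IsBigO.norm_left (Asymptotics.IsBigO.prod_left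
      (f' := fun z : ℂ × ℂ => z.1) (g' := fun z : ℂ × ℂ => z.1 * (z.2 + c))
      (Asymptotics.isBigO_refl _ _) ?_)
    have hb : (fun z : ℂ × ℂ => z.2 + c) =O[𝓝 0] fun _ => (1 : ℂ) :=
      (ContinuousAt.tendsto (by fun_prop)).isBigO_one ℂ
    simpa using (Asymptotics.isBigO_refl (fun z : ℂ × ℂ => z.1) (𝓝 0)).mul hb
  exact ((hfO.comp_tendsto (tendsto_directionChart _)).trans (hχ.pow a)).trans hθ.1

end Charts

/-! ### Descent along a blow-up and the induction -/

/-- Estimates at all points of the exceptional curve of a blow-up descend. -/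
theorem isBigO_of_directionChart {f : ℂ × ℂ → ℂ} {S : ℂ × ℂ → ℝ} (hS : ∀ z, 0 ≤ S z)
    (h : ∀ d, (f ∘ directionChart d) =O[𝓝 0] fun z => S (directionChart d z)) :
    f =O[𝓝 0] S := by
  have hbound : ∀ d, ∃ C : ℝ, ∃ ε > 0, ∀ x y : ℂ, ‖x‖ < ε → ‖y‖ < ε →
      ‖f (directionChart d (x, y))‖ ≤ C * S (directionChart d (x, y)) := by
    intro d
    obtain ⟨C, hC⟩ := (h d).bound
    obtain ⟨ε, hε, hb⟩ := Metric.eventually_nhds_iff_ball.1 hC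
    refine ⟨C, ε, hε, fun x y hx hy => ?_⟩
    have := hb (x, y) (by simpa [Prod.norm_def] using ⟨hx, hy⟩)
    rwa [Real.norm_of_nonneg (hS _)] at this
  obtain ⟨C₀, ε, hε, h₀⟩ := hbound OnePoint.infty
  have hK : ∃ C : ℝ, ∃ δ > 0, ∀ x : ℂ, ‖x‖ < δ → ∀ k ∈ Metric.closedBall (0 : ℂ) (1 / ε),
      ‖f (x, x * k)‖ ≤ C * S (x, x * k) := by
    -- The chart at infinity handles $|x/y|<\varepsilon$. The remaining slopes fill a compact disc,
    -- covered by finitely many finite charts.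
    refine (isCompact_closedBall (0 : ℂ) (1 / ε)).induction_on
      (p := fun s => ∃ C : ℝ, ∃ δ > 0, ∀ x : ℂ, ‖x‖ < δ → ∀ k ∈ s,
        ‖f (x, x * k)‖ ≤ C * S (x, x * k)) ⟨0, 1, one_pos, by simp⟩ ?_ ?_ ?_
    · rintro s t hst ⟨C, δ, hδ, hC⟩
      exact ⟨C, δ, hδ, fun x hx k hk => hC x hx k (hst hk)⟩
    · rintro s t ⟨C, δ, hδ, hC⟩ ⟨C', δ', hδ', hC'⟩
      refine ⟨max C C', min δ δ', lt_min hδ hδ', fun x hx k hk => ?_⟩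
      rcases hk with hk | hk
      · exact (hC x (hx.trans_le (min_le_left _ _)) k hk).trans
          (mul_le_mul_of_nonneg_right (le_max_left _ _) (hS _))
      · exact (hC' x (hx.trans_le (min_le_right _ _)) k hk).trans
          (mul_le_mul_of_nonneg_right (le_max_right _ _) (hS _))
    · intro c _
      obtain ⟨C, δ, hδ, hC⟩ := hbound (c : OnePoint ℂ)
      refine ⟨Metric.ball c δ, mem_nhdsWithin_of_mem_nhds (Metric.ball_mem_nhds c hδ), C, δ, hδ,
        fun x hx k hk => ?_⟩
      have := hC x (k - c) hx (mem_ball_iff_norm.1 hk)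
      change ‖f (x, x * (k - c + c))‖ ≤ C * S (x, x * (k - c + c)) at this
      rwa [sub_add_cancel] at this
  obtain ⟨C₁, δ, hδ, h₁⟩ := hK
  refine Asymptotics.IsBigO.of_bound (max C₀ C₁) ?_
  filter_upwards [Metric.ball_mem_nhds (0 : ℂ × ℂ) (lt_min hε hδ)] with z hz
  rw [Real.norm_of_nonneg (hS z)]
  have hz : (‖z.1‖ < ε ∧ ‖z.2‖ < ε) ∧ ‖z.1‖ < δ ∧ ‖z.2‖ < δ := by
    simpa [Prod.norm_def] using hz
  by_cases hcase : z.2 ≠ 0 ∧ ‖z.1 / z.2‖ < ε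
  · have := h₀ (z.1 / z.2) z.2 hcase.2 hz.1.2
    change ‖f (z.1 / z.2 * z.2, z.2)‖ ≤ C₀ * S (z.1 / z.2 * z.2, z.2) at this
    rw [div_mul_cancel₀ _ hcase.1] at this
    exact this.trans (mul_le_mul_of_nonneg_right (le_max_left _ _) (hS _))
  · have hle : ε * ‖z.2‖ ≤ ‖z.1‖ := by
      by_cases h2 : z.2 = 0
      · simp [h2]
      · have := not_lt.1 fun h => hcase ⟨h2, h⟩
        rwa [norm_div, le_div_iff₀ (norm_pos_iff.2 h2)] at this
    -- This includes $x=0$, where $\varepsilon|y|\le|x|$ gives $y=0$ and the quotient has the value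
    -- $0$.
    have hmul : z.1 * (z.2 / z.1) = z.2 := by
      by_cases h1 : z.1 = 0
      · have : ‖z.2‖ ≤ 0 := by
          rw [h1, norm_zero] at hle
          exact nonpos_of_mul_nonpos_right hle hε
        simp [norm_le_zero_iff.1 this]
      · exact mul_div_cancel₀ _ h1
    have hk : z.2 / z.1 ∈ Metric.closedBall (0 : ℂ) (1 / ε) := by
      rw [mem_closedBall_zero_iff, norm_div]
      refine div_le_of_le_mul₀ (norm_nonneg _) (by positivity) ?_
      rw [one_div, ← div_eq_inv_mul, le_div_iff₀ hε, mul_comm]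
      exact hle
    have := h₁ z.1 hz.2.1 _ hk
    rw [hmul] at this
    exact this.trans (mul_le_mul_of_nonneg_right (le_max_right _ _) (hS _))

theorem isRealDirection_or_nonreal (d : OnePoint ℂ) :
    IsRealDirection d ∨ ∃ c : ℂ, c.im ≠ 0 ∧ d = (c : OnePoint ℂ) := by
  cases d with
  | infty => exact Or.inl (Or.inl rfl)
  | coe c =>
    by_cases hc : c.im = 0
    · refine Or.inl (Or.inr ⟨c.re, ?_⟩)
      rw [show ((c.re : ℝ) : ℂ) = c from Complex.ext rfl (by simp [hc])]
    · exact Or.inr ⟨c, hc, rfl⟩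

/-- If an ideal has a monomialization blowing up only real points and the branches of its zero
curve are real, then real estimates by its generators extend to complex points. -/
theorem PointBlowUps.isBigO_of_real {m : ℕ} {f : ℂ × ℂ → ℂ} (T : PointBlowUps)
    {g : Fin m → ℂ × ℂ → ℂ} (hg : ∀ i, AnalyticAt ℂ (g i) 0) (hT : T.OnlyReal)
    (hmono : T.IsMonomialization g) (hreal : ZeroCurveHasRealBranches g)
    (hf : AnalyticAt ℂ f 0)
    (h : (fun p => f (toComplexPt p)) =O[𝓝 0] fun p => ∑ i, ‖g i (toComplexPt p)‖) :
    f =O[𝓝 0] fun z => ∑ i, ‖g i z‖ := by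
  induction T generalizing g f with
  | nothing => exact isBigO_of_isMonomialAtOrigin (hmono id .origin) hreal hf h
  | blowUp S next ih =>
    obtain _ | ⟨_, _, hS, hnext⟩ := hT
    refine isBigO_of_directionChart (fun z => Finset.sum_nonneg fun i _ => norm_nonneg _) fun d => ?_
    by_cases hd : d ∈ S
    · exact ih d (fun i => (hg i).comp_directionChart d) (hnext d hd)
        (fun χ hχ => hmono _ (.continued S next d hd χ hχ))
        (hreal.comp_directionChart (hS d hd)) (hf.comp_directionChart d)
        (isBigO_real_comp_directionChart (hS d hd) h)
    -- Every non-real direction falls here, since $S$ contains only real ones.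
    · have hmon := hmono _ (.unchanged S next d hd)
      rcases isRealDirection_or_nonreal d with hdr | ⟨c, hc, rfl⟩
      · exact isBigO_of_isMonomialAtOrigin hmon (hreal.comp_directionChart hdr)
          (hf.comp_directionChart d) (isBigO_real_comp_directionChart hdr h)
      · exact isBigO_of_nonreal hg hreal hc hmon hf h

theorem mainTheorem3 {m : ℕ} (g : Fin m → ℂ × ℂ → ℂ) (hg : ∀ i, IsRealSeries (g i))
    (hmono : ∃ T : PointBlowUps, T.OnlyReal ∧ T.IsMonomialization g)
    (hreal : ZeroCurveHasRealBranches g)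
    (f : ℂ × ℂ → ℂ) (hf : AnalyticAt ℂ f 0) :
    (∃ C : ℝ, 0 < C ∧ ∀ᶠ p in 𝓝 (0 : ℝ × ℝ),
        ‖f (toComplexPt p)‖ ≤ C * ∑ i, ‖g i (toComplexPt p)‖) ↔
      (∃ C : ℝ, 0 < C ∧ ∀ᶠ z in 𝓝 (0 : ℂ × ℂ), ‖f z‖ ≤ C * ∑ i, ‖g i z‖) := by
  constructor
  · rintro ⟨C, -, hC⟩
    obtain ⟨T, hT, hmono⟩ := hmono
    have h : (fun p => f (toComplexPt p)) =O[𝓝 0] fun p => ∑ i, ‖g i (toComplexPt p)‖ := by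
      refine Asymptotics.IsBigO.of_bound C ?_
      filter_upwards [hC] with p hp
      rwa [Real.norm_of_nonneg (Finset.sum_nonneg fun i _ => norm_nonneg _)]
    obtain ⟨C', hC'0, hC'⟩ := (T.isBigO_of_real (fun i => (hg i).1) hT hmono hreal hf h).exists_pos
    refine ⟨C', hC'0, ?_⟩
    filter_upwards [hC'.bound] with z hz
    rwa [Real.norm_of_nonneg (Finset.sum_nonneg fun i _ => norm_nonneg _)] at hz
  · rintro ⟨C, hC0, hC⟩
    exact ⟨C, hC0, tendsto_toComplexPt.eventually hC⟩
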